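/- Let $\mathbb G$ be a compact Lie group equipped with a bi-invariant Riemannian metric, let $\mathcal L$ be its Laplace–Beltrami operator, let $\mathrm dx$ be the normalized Haar measure, and let $H^1_{\mathcal L}(\mathbb G)=\{f\in L^2(\mathbb G):(-\mathcal L)^{1/2}f\in L^2(\mathbb G)\}$ with norm $\|f\|_{L^2}+\|(-\mathcal L)^{1/2}f\|_{L^2}$ (real-valued functions). Let $b>0$ and $p,q>1$. Let $u_0,v_0\in H^1_{\mathcal L}(\mathbb G)$ and $u_1,v_1\in L^2(\mathbb G)$ be non-negative functions such that $(u_0,u_1)\ne(0,0)$ and $(v_0,v_1)\neq(0,0)$. For $\varepsilon>0$ consider the weakly coupled system $$\begin{cases}\partial_t^2u-\mathcal Lu+b\,\partial_tu=|v|^p,\\ \partial_t^2v-\mathcal Lv=|u|^q,\end{cases}\qquad (u,\partial_tu)(0,\cdot)=\varepsilon(u_0,u_1),\quad (v,\partial_tv)(0,\cdot)=\varepsilon(v_0,v_1),$$ for $x\in\mathbb G$, $t>0$. For $T>0$, a pair $(u,v)$ is called an energy solution on $[0,T)$ if $$u\in\mathcal C([0,T),H^1_{\mathcal L}(\mathbb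 G))\cap\mathcal C^1([0,T),L^2(\mathbb G))\cap L^q_{\mathrm{loc}}([0,T)\times\mathbb G),$$ $$v\in\mathcal C([0,T),H^1_{\mathcal L}(\mathbb G))\cap\mathcal C^1([0,T),L^2(\mathbb G))\cap L^p_{\mathrm{loc}}([0,T)\times\mathbb G),$$ and, for all $\psi,\varphi\in\mathcal C_0^\infty([0,T)\times\mathbb G)$ and all $t\in(0,T)$, $$\begin{aligned}\int_0^t\!\!\int_{\mathbb G}|v|^p\psi\,\mathrm dx\,\mathrm ds={}&\int_{\mathbb G}\big(\partial_tu\,\psi-u\,\partial_s\psi+b\,u\,\psi\big)(t,x)\,\mathrm dx-\varepsilon\int_{\mathbb G}\big(u_1\psi(0,x)-u_0\,\partial_s\psi(0,x)+b\,u_0\psi(0,x)\big)\,\mathrm dx\\&+\int_0^t\!\!\int_{\mathbb G}u\,\big(\partial_s^2\psi-\mathcal L\psi-b\,\partial_s\psi\big)\,\mathrm dx\,\mathrm ds,\end{aligned}$$ $$\begin{aligned}\int_0^t\!\!\int_{\mathbb G}|u|^q\varphi\,\mathrm dx\,\mathrm ds={}&\int_{\mathbb G}\big(\partial_tv\,\varphi-v\,\partial_s\varphi\big)(t,x)\,\mathrm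 dx-\varepsilon\int_{\mathbb G}\big(v_1\varphi(0,x)-v_0\,\partial_s\varphi(0,x)\big)\,\mathrm dx\\&+\int_0^t\!\!\int_{\mathbb G}v\,\big(\partial_s^2\varphi-\mathcal L\varphi\big)\,\mathrm dx\,\mathrm ds.\end{aligned}$$ The lifespan of $(u,v)$ is $T(\varepsilon)=\sup\{\tau>0:(u,v)\text{ is an energy solution on }[0,\tau)\}\in(0,\infty]$. Then there exist constants $\varepsilon_0>0$ and $C>0$, independent of $\varepsilon$ and of the solution, such that for every $\varepsilon\in(0,\varepsilon_0]$ every energy solution $(u,v)$ blows up in finite time, i.e. $T(\varepsilon)<\infty$, and its lifespan satisfies $$T(\varepsilon)\le\begin{cases}C\,\varepsilon^{-\frac{pq-1}{\max\{2p+1,\,pq+q+1\}}}&\text{if }v_1\neq0,\\[4pt] C\,\varepsilon^{-\frac{pq-1}{\max\{2p+1,\,q+2\}}}&\text{if }v_1=0.\end{cases}$$ -/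

import Mathlib

open MeasureTheory Set
open scoped Manifold ContDiff Topology ENNReal

noncomputable section

/-- A smooth Riemannian metric on a smooth `n`-dimensional manifold `M`. -/
abbrev SmoothMetric (n : ℕ) (M : Type*) [TopologicalSpace M]
    [ChartedSpace (EuclideanSpace ℝ (Fin n)) M] [IsManifold (𝓡 n) ∞ M] :=
  Bundle.ContMDiffRiemannianMetric (𝓡 n) ∞ (EuclideanSpace ℝ (Fin n))
    (TangentSpace (M := M) (𝓡 n))

section LaplaceBeltrami

variable {n : ℕ} {M : Type*} [TopologicalSpace M] [ChartedSpace (EuclideanSpace ℝ (Fin n)) M]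
  [IsManifold (𝓡 n) ∞ M]

/-- The `i`-th coordinate vector field of the preferred chart at `x₀`, at the point with
coordinates `y`. -/
def coordField (x₀ : M) (i : Fin n) (y : EuclideanSpace ℝ (Fin n)) :
    TangentSpace (𝓡 n) ((extChartAt (𝓡 n) x₀).symm y) :=
  mfderiv 𝓘(ℝ, EuclideanSpace ℝ (Fin n)) (𝓡 n) (extChartAt (𝓡 n) x₀).symm y
    (EuclideanSpace.single i (1 : ℝ) : EuclideanSpace ℝ (Fin n))

/-- The matrix `(g_{ij})` of the metric in the preferred chart at `x₀`, at the point with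
coordinates `y`. -/
def metricMatrix (g : SmoothMetric n M) (x₀ : M) (y : EuclideanSpace ℝ (Fin n)) :
    Matrix (Fin n) (Fin n) ℝ :=
  Matrix.of fun i j =>
    g.inner ((extChartAt (𝓡 n) x₀).symm y) (coordField x₀ i y) (coordField x₀ j y)

/-- The `i`-th partial derivative of a function on `ℝⁿ`. -/
def partialDeriv (i : Fin n) (h : EuclideanSpace ℝ (Fin n) → ℝ) (y : EuclideanSpace ℝ (Fin n)) :
    ℝ :=
  fderiv ℝ h y (EuclideanSpace.single i (1 : ℝ))

/-- The Laplace-Beltrami operator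
`𝓛 f = |g|^{-1/2} ∑ᵢ ∂ᵢ (|g|^{1/2} ∑ⱼ g^{ij} ∂ⱼ f)`,
evaluated at `x` in the preferred chart at `x`. -/
def laplaceBeltrami (g : SmoothMetric n M) (f : M → ℝ) (x : M) : ℝ :=
  (Real.sqrt (metricMatrix g x (extChartAt (𝓡 n) x x)).det)⁻¹ *
    ∑ i, partialDeriv i
      (fun y => Real.sqrt (metricMatrix g x y).det *
        ∑ j, (metricMatrix g x y)⁻¹ i j *
          partialDeriv j (f ∘ (extChartAt (𝓡 n) x).symm) y)
      (extChartAt (𝓡 n) x x)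

end LaplaceBeltrami

/-- A Riemannian metric on a Lie group is bi-invariant if all left and right translations are
isometries. -/
def IsBiinvariantMetric {n : ℕ} {G : Type*} [Group G] [TopologicalSpace G]
    [ChartedSpace (EuclideanSpace ℝ (Fin n)) G] [IsManifold (𝓡 n) ∞ G]
    (g : SmoothMetric n G) : Prop :=
  ∀ (a x : G) (v w : TangentSpace (𝓡 n) x),
    g.inner (a * x) (mfderiv (𝓡 n) (𝓡 n) (fun z : G => a * z) x v)
        (mfderiv (𝓡 n) (𝓡 n) (fun z : G => a * z) x w) = g.inner x v w ∧
    g.inner (x * a) (mfderiv (𝓡 n) (𝓡 n) (fun z : G => z * a) x v)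
        (mfderiv (𝓡 n) (𝓡 n) (fun z : G => z * a) x w) = g.inner x v w

section Sobolev

variable {n : ℕ} {M : Type*} [TopologicalSpace M] [ChartedSpace (EuclideanSpace ℝ (Fin n)) M]
  [IsManifold (𝓡 n) ∞ M] [MeasurableSpace M]

/-- `e` is a smooth solution of `-𝓛 e = lam e`. -/
def IsLaplaceEigenfunction (g : SmoothMetric n M) (lam : ℝ) (e : M → ℝ) : Prop :=
  ContMDiff (𝓡 n) 𝓘(ℝ, ℝ) ∞ e ∧ ∀ x, -laplaceBeltrami g e x = lam * e x

/-- `w = (-𝓛)^(σ/2) f` in `L²(M)`, in the sense of the spectral decomposition of `-𝓛`: on a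
compact manifold `L²` is the Hilbert sum of the eigenspaces of `-𝓛` (which consist of smooth
functions), and `(-𝓛)^(σ/2)` acts on the eigenspace of `lam` as multiplication by
`lam^(σ/2)`. -/
def IsFracLaplacian (g : SmoothMetric n M) (μ : Measure M) (σ : ℝ) (f w : Lp ℝ 2 μ) : Prop :=
  ∀ (lam : ℝ) (e : M → ℝ), 0 ≤ lam → IsLaplaceEigenfunction g lam e →
    ∫ x, w x * e x ∂μ = lam ^ (σ / 2) * ∫ x, f x * e x ∂μ

/-- Membership in the Sobolev space `H¹_𝓛 = {f ∈ L² : (-𝓛)^(1/2) f ∈ L²}`. -/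
def MemSobolevH1 (g : SmoothMetric n M) (μ : Measure M) (f : Lp ℝ 2 μ) : Prop :=
  ∃ w : Lp ℝ 2 μ, IsFracLaplacian g μ 1 f w

/-- `u ∈ 𝓒([0,T), H¹_𝓛)`, where `‖f‖_{H¹} = ‖f‖_{L²} + ‖(-𝓛)^(1/2) f‖_{L²}`: both `u` and
`(-𝓛)^(1/2) u` are continuous with values in `L²`. -/
def ContinuousInH1 (g : SmoothMetric n M) (μ : Measure M) (T : ℝ) (u : ℝ → Lp ℝ 2 μ) : Prop :=
  ContinuousOn u (Ico 0 T) ∧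
  ∃ w : ℝ → Lp ℝ 2 μ, (∀ t ∈ Ico 0 T, IsFracLaplacian g μ 1 (u t) (w t)) ∧
    ContinuousOn w (Ico 0 T)

/-- `u ∈ L^r_loc([0,T) × M)` for `M` compact: the function on `[0,T) × M` defined by the curve `u`
is measurable, and `r`-integrable on `[0,t] × M` for every `t < T`. -/
def MemLrLoc (μ : Measure M) (T r : ℝ) (u : ℝ → Lp ℝ 2 μ) : Prop :=
  ∃ w : ℝ × M → ℝ,
    (∀ᵐ s ∂(volume.restrict (Ico 0 T)), (fun x => w (s, x)) =ᵐ[μ] u s) ∧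
    ∀ t ∈ Ico 0 T, MemLp w (ENNReal.ofReal r) ((volume.restrict (Icc 0 t)).prod μ)

/-- The time derivative `∂ₜu(t) ∈ L²` of a curve `u : [0,T) → L²` (one-sided at `t = 0`). -/
def timeDeriv {μ : Measure M} (T : ℝ) (u : ℝ → Lp ℝ 2 μ) (t : ℝ) : Lp ℝ 2 μ :=
  derivWithin u (Ico 0 T) t

/-- `u ∈ 𝓒([0,T), H¹_𝓛) ∩ 𝓒¹([0,T), L²) ∩ L^r_loc([0,T) × M)`. -/
def InEnergyClass (g : SmoothMetric n M) (μ : Measure M) (T r : ℝ) (u : ℝ → Lp ℝ 2 μ) : Prop :=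
  ContinuousInH1 g μ T u ∧ ContDiffOn ℝ 1 u (Ico 0 T) ∧ MemLrLoc μ T r u

end Sobolev

section EnergySolution

variable {n : ℕ} {M : Type*} [TopologicalSpace M] [ChartedSpace (EuclideanSpace ℝ (Fin n)) M]

/-- `ψ ∈ 𝓒₀^∞([0,T) × M)` for `M` compact: `ψ` is the restriction of a smooth function on `ℝ × M`
and vanishes for times close to `T` (but not necessarily at time `0`). -/
def IsTestFunction (T : ℝ) (ψ : ℝ → M → ℝ) : Prop :=
  ContMDiff (𝓘(ℝ, ℝ).prod (𝓡 n)) 𝓘(ℝ, ℝ) ∞ (fun z : ℝ × M => ψ z.1 z.2) ∧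
  ∃ τ < T, ∀ s, τ ≤ s → ∀ x, ψ s x = 0

variable [IsManifold (𝓡 n) ∞ M] [MeasurableSpace M]

/-- The integral relation, for all test functions `ψ` and all `t ∈ (0,T)`, which encodes
`∂ₜ²u - 𝓛u + b ∂ₜu + m² u = |F|^r`, `(u, ∂ₜu)(0) = ε (u₀, u₁)`. -/
def WeakWaveRelation (g : SmoothMetric n M) (μ : Measure M) (b m r ε T : ℝ)
    (u₀ u₁ : Lp ℝ 2 μ) (u F : ℝ → Lp ℝ 2 μ) : Prop :=
  ∀ ψ : ℝ → M → ℝ, IsTestFunction (n := n) T ψ → ∀ t ∈ Ioo 0 T,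
    ∫ s in (0 : ℝ)..t, ∫ x, |F s x| ^ r * ψ s x ∂μ =
      (∫ x, timeDeriv T u t x * ψ t x ∂μ)
      - (∫ x, u t x * deriv (fun s => ψ s x) t ∂μ)
      + b * (∫ x, u t x * ψ t x ∂μ)
      - ε * (∫ x, u₁ x * ψ 0 x ∂μ)
      + ε * (∫ x, u₀ x * deriv (fun s => ψ s x) 0 ∂μ)
      - ε * b * (∫ x, u₀ x * ψ 0 x ∂μ)
      + ∫ s in (0 : ℝ)..t, ∫ x, u s x *
          (iteratedDeriv 2 (fun s' => ψ s' x) s - laplaceBeltrami g (ψ s) x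
            - b * deriv (fun s' => ψ s' x) s + m ^ 2 * ψ s x) ∂μ

/-- `(u,v)` is an energy solution on `[0,T)` of the weakly coupled system
`∂ₜ²u - 𝓛u + b ∂ₜu + m² u = |v|^p`, `∂ₜ²v - 𝓛v = |u|^q`
with Cauchy data `ε (u₀,u₁)` and `ε (v₀,v₁)`. -/
def IsEnergySolution (g : SmoothMetric n M) (μ : Measure M) (b m p q ε : ℝ)
    (u₀ u₁ v₀ v₁ : Lp ℝ 2 μ) (T : ℝ) (u v : ℝ → Lp ℝ 2 μ) : Prop :=
  InEnergyClass g μ T q u ∧ InEnergyClass g μ T p v ∧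
  WeakWaveRelation g μ b m p ε T u₀ u₁ u v ∧
  WeakWaveRelation g μ 0 0 q ε T v₀ v₁ v u

/-- The lifespan `sup {τ > 0 : (u,v) is an energy solution on [0,τ)} ∈ [0,∞]`. -/
def lifespan (g : SmoothMetric n M) (μ : Measure M) (b m p q ε : ℝ)
    (u₀ u₁ v₀ v₁ : Lp ℝ 2 μ) (u v : ℝ → Lp ℝ 2 μ) : ℝ≥0∞ :=
  sSup (ENNReal.ofReal ''
    {τ : ℝ | 0 < τ ∧ IsEnergySolution g μ b m p q ε u₀ u₁ v₀ v₁ τ u v})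

end EnergySolution

end

/-! A test function `ψ(s, x) = φ(s)` depending on time only satisfies `𝓛 ψ = 0`, so the integral
relations reduce to relations for the means of `u` and `v`, and no geometry is left. Take for `φ` a
cutoff at scale `τ < T` and set `X = ∫∫ |v|^p φ`, `Y = ∫∫ |u|^q φ`. By Jensen's inequality in `x`
and in `s`, the terms with derivatives of `φ` are controlled by `Y` (for `u`) and by `X` (for `v`):
`(X + ε A)^q ≤ K τ^(-1) Y` and `(Y + ε B)^p ≤ L τ^(-(p+1)) X`, where
`A ∼ ∫ u₁ + b ∫ u₀` and `B ∼ ∫ v₁ + τ⁻¹ ∫ v₀`; the damping term `b φ'`, of order `τ⁻¹`, is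
responsible for the weaker decay in the first one. Eliminating `Y`, respectively `X`, gives
`(ε A)^(pq-1) τ^(2p+1) ≤ K^p L` and `(ε B)^(pq-1) τ^(pq+q+1) ≤ L^q K`; now let `τ → T`. -/

section Cutoff

open Polynomial in
theorem exists_abs_eval_inv_mul_expNegInvGlue_le (P : ℝ[X]) {θ : ℝ} (hθ : θ < 1) (c : ℝ) :
    ∃ K : ℝ, 0 ≤ K ∧ ∀ x ≤ c, |P.eval x⁻¹ * expNegInvGlue x| ≤ K * expNegInvGlue x ^ θ := by
  have hθ' : 0 < 1 - θ := sub_pos.2 hθ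
  obtain ⟨K, hK⟩ := (isCompact_Icc (a := 0) (b := c / (1 - θ))).exists_bound_of_continuousOn
    (expNegInvGlue.continuous_polynomial_eval_inv_mul
      (P.comp (C (1 - θ)⁻¹ * X))).continuousOn
  refine ⟨|K|, abs_nonneg K, fun x hxc => ?_⟩
  rcases le_or_gt x 0 with hx | hx
  · rw [expNegInvGlue.zero_of_nonpos hx, mul_zero, abs_zero]
    positivity
  -- The power `1 - θ` of `exp (-1 / x)` left over after splitting off the power `θ` is
  -- `exp (-1 / y)` for `y = x / (1 - θ)`.
  have split : expNegInvGlue x = expNegInvGlue (x / (1 - θ)) * expNegInvGlue x ^ θ := by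
    simp only [expNegInvGlue, hx.not_ge, (div_pos hx hθ').not_ge, if_false]
    rw [← Real.exp_mul, ← Real.exp_add, inv_div]
    ring_nf
  have bound := hK (x / (1 - θ)) ⟨by positivity, by gcongr⟩
  have eval_eq : (P.comp (C (1 - θ)⁻¹ * X)).eval (x / (1 - θ))⁻¹ = P.eval x⁻¹ := by
    rw [eval_comp, eval_mul, eval_C, eval_X, inv_div, div_eq_mul_inv,
      inv_mul_cancel_left₀ hθ'.ne']
  rw [eval_eq, Real.norm_eq_abs] at bound
  have hnn : 0 ≤ expNegInvGlue x ^ θ := Real.rpow_nonneg (expNegInvGlue.nonneg x) θ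
  calc |P.eval x⁻¹ * expNegInvGlue x|
      = |P.eval x⁻¹ * expNegInvGlue (x / (1 - θ))| * expNegInvGlue x ^ θ := by
        conv_rhs => rw [← abs_of_nonneg hnn, ← abs_mul, mul_assoc, ← split]
    _ ≤ |K| * expNegInvGlue x ^ θ :=
        mul_le_mul_of_nonneg_right (bound.trans (le_abs_self K)) hnn

/-- The cutoff `exp (-1 / (1 - s / τ))` in time, extended by zero to `s ≥ τ`. It plays the role of
the `k`-th power of a bump function, `k` large: its derivatives are dominated by each of its own
powers with exponent less than `1`. -/
noncomputable def timeCutoff (τ s : ℝ) : ℝ :=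
  expNegInvGlue (1 - s / τ)

theorem timeCutoff_nonneg (τ s : ℝ) : 0 ≤ timeCutoff τ s :=
  expNegInvGlue.nonneg _

theorem timeCutoff_eq_zero {τ s : ℝ} (hτ : 0 < τ) (hs : τ ≤ s) : timeCutoff τ s = 0 :=
  expNegInvGlue.zero_of_nonpos (sub_nonpos.2 ((one_le_div hτ).2 hs))

theorem timeCutoff_zero_right (τ : ℝ) : timeCutoff τ 0 = Real.exp (-1) := by
  norm_num [timeCutoff, expNegInvGlue]

theorem contDiff_timeCutoff (τ : ℝ) : ContDiff ℝ ∞ (timeCutoff τ) :=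
  expNegInvGlue.contDiff.comp (contDiff_const.sub (contDiff_id.div_const τ))

open Polynomial in
theorem hasDerivAt_eval_inv_mul_timeCutoff (P : ℝ[X]) (τ s : ℝ) :
    HasDerivAt (fun s => P.eval (1 - s / τ)⁻¹ * timeCutoff τ s)
      (-τ⁻¹ * ((X ^ 2 * (P - derivative P)).eval (1 - s / τ)⁻¹ * timeCutoff τ s)) s := by
  have inner : HasDerivAt (fun s => 1 - s / τ) (-τ⁻¹) s := by
    simpa using ((hasDerivAt_id s).div_const τ).const_sub 1
  rw [mul_comm]
  exact (expNegInvGlue.hasDerivAt_polynomial_eval_inv_mul P (1 - s / τ)).comp s inner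

open Polynomial in
theorem deriv_timeCutoff (τ : ℝ) :
    deriv (timeCutoff τ) =
      fun s => -τ⁻¹ * ((X ^ 2 : ℝ[X]).eval (1 - s / τ)⁻¹ * timeCutoff τ s) := by
  funext s
  simpa using (hasDerivAt_eval_inv_mul_timeCutoff 1 τ s).deriv

theorem deriv_timeCutoff_zero (τ : ℝ) : deriv (timeCutoff τ) 0 = -(τ⁻¹ * Real.exp (-1)) := by
  simp [deriv_timeCutoff, timeCutoff_zero_right]

open Polynomial in
theorem iteratedDeriv_two_timeCutoff (τ s : ℝ) :
    iteratedDeriv 2 (timeCutoff τ) s = τ⁻¹ ^ 2 *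
      ((X ^ 2 * (X ^ 2 - derivative (X ^ 2)) : ℝ[X]).eval (1 - s / τ)⁻¹ * timeCutoff τ s) := by
  rw [iteratedDeriv_succ, iteratedDeriv_one, deriv_timeCutoff,
    ((hasDerivAt_eval_inv_mul_timeCutoff (X ^ 2) τ s).const_mul (-τ⁻¹)).deriv]
  ring

theorem exists_abs_deriv_timeCutoff_le {θ : ℝ} (hθ : θ < 1) :
    ∃ K : ℝ, 0 ≤ K ∧ ∀ τ s : ℝ, 0 < τ → 0 ≤ s →
      |deriv (timeCutoff τ) s| ≤ K * τ⁻¹ * timeCutoff τ s ^ θ ∧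
      |iteratedDeriv 2 (timeCutoff τ) s| ≤ K * τ⁻¹ ^ 2 * timeCutoff τ s ^ θ := by
  obtain ⟨K₁, hK₁, h₁⟩ := exists_abs_eval_inv_mul_expNegInvGlue_le (.X ^ 2) hθ 1
  obtain ⟨K₂, -, h₂⟩ := exists_abs_eval_inv_mul_expNegInvGlue_le
    (.X ^ 2 * (.X ^ 2 - Polynomial.derivative (.X ^ 2))) hθ 1
  refine ⟨max K₁ K₂, le_max_of_le_left hK₁, fun τ s hτ hs => ?_⟩
  have hx : 1 - s / τ ≤ 1 := sub_le_self 1 (by positivity)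
  have hφ : 0 ≤ timeCutoff τ s ^ θ := Real.rpow_nonneg (timeCutoff_nonneg τ s) θ
  have hτ' : 0 < τ⁻¹ := inv_pos.2 hτ
  rw [deriv_timeCutoff, iteratedDeriv_two_timeCutoff, abs_mul, abs_mul (τ⁻¹ ^ 2), abs_neg,
    abs_of_pos hτ', abs_of_pos (pow_pos hτ' 2), mul_comm (max K₁ K₂), mul_comm (max K₁ K₂),
    mul_assoc, mul_assoc]
  constructor <;> gcongr
  · exact (h₁ _ hx).trans (mul_le_mul_of_nonneg_right (le_max_left K₁ K₂) hφ)
  · exact (h₂ _ hx).trans (mul_le_mul_of_nonneg_right (le_max_right K₁ K₂) hφ)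

theorem exists_abs_iteratedDeriv_two_timeCutoff_rpow_le {r : ℝ} (hr : 1 < r) :
    ∃ K : ℝ, 0 ≤ K ∧ ∀ τ s : ℝ, 0 < τ → 0 ≤ s →
      |iteratedDeriv 2 (timeCutoff τ) s| ^ r ≤ K * τ ^ (-(2 * r)) * timeCutoff τ s := by
  have hr0 : 0 < r := by linarith
  obtain ⟨K, hK, h⟩ := exists_abs_deriv_timeCutoff_le (inv_lt_one_of_one_lt₀ hr)
  refine ⟨K ^ r, by positivity, fun τ s hτ hs => ?_⟩
  have hφ := timeCutoff_nonneg τ s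
  calc |iteratedDeriv 2 (timeCutoff τ) s| ^ r
      ≤ (K * τ⁻¹ ^ 2 * timeCutoff τ s ^ r⁻¹) ^ r := by gcongr; exact (h τ s hτ hs).2
    _ = K ^ r * τ ^ (-(2 * r)) * timeCutoff τ s := by
        rw [Real.mul_rpow (by positivity) (by positivity), Real.mul_rpow hK (by positivity),
          Real.rpow_inv_rpow hφ hr0.ne', ← Real.rpow_neg_one, ← Real.rpow_natCast,
          ← Real.rpow_mul hτ.le, ← Real.rpow_mul hτ.le]
        norm_num

theorem exists_abs_damped_timeCutoff_rpow_le (b : ℝ) {r : ℝ} (hr : 1 < r) :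
    ∃ K : ℝ, 0 ≤ K ∧ ∀ τ s : ℝ, 1 ≤ τ → 0 ≤ s →
      |iteratedDeriv 2 (timeCutoff τ) s - b * deriv (timeCutoff τ) s| ^ r ≤
        K * τ ^ (-r) * timeCutoff τ s := by
  have hr0 : 0 < r := by linarith
  obtain ⟨K, hK, h⟩ := exists_abs_deriv_timeCutoff_le (inv_lt_one_of_one_lt₀ hr)
  refine ⟨(K * (1 + |b|)) ^ r, by positivity, fun τ s hτ hs => ?_⟩
  have hτ0 : 0 < τ := by linarith
  have hφ := timeCutoff_nonneg τ s
  obtain ⟨h₁, h₂⟩ := h τ s hτ0 hs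
  have hsq : τ⁻¹ ^ 2 ≤ τ⁻¹ := pow_le_of_le_one (by positivity) (inv_le_one_of_one_le₀ hτ)
    two_ne_zero
  have linear : |iteratedDeriv 2 (timeCutoff τ) s - b * deriv (timeCutoff τ) s| ≤
      K * (1 + |b|) * τ⁻¹ * timeCutoff τ s ^ r⁻¹ := by
    calc |iteratedDeriv 2 (timeCutoff τ) s - b * deriv (timeCutoff τ) s|
        ≤ |iteratedDeriv 2 (timeCutoff τ) s| + |b| * |deriv (timeCutoff τ) s| := by
          rw [← abs_mul]
          exact abs_sub _ _
      _ ≤ K * τ⁻¹ * timeCutoff τ s ^ r⁻¹ + |b| * (K * τ⁻¹ * timeCutoff τ s ^ r⁻¹) := by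
          gcongr
          exact h₂.trans (by gcongr)
      _ = K * (1 + |b|) * τ⁻¹ * timeCutoff τ s ^ r⁻¹ := by ring
  calc |iteratedDeriv 2 (timeCutoff τ) s - b * deriv (timeCutoff τ) s| ^ r
      ≤ (K * (1 + |b|) * τ⁻¹ * timeCutoff τ s ^ r⁻¹) ^ r := by gcongr
    _ = (K * (1 + |b|)) ^ r * τ ^ (-r) * timeCutoff τ s := by
        rw [Real.mul_rpow (by positivity) (by positivity), Real.mul_rpow (by positivity)
          (by positivity), Real.rpow_inv_rpow hφ hr0.ne', Real.inv_rpow hτ0.le,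
          Real.rpow_neg hτ0.le]

end Cutoff

section Means

variable {α : Type*} [MeasurableSpace α]

theorem abs_integral_rpow_le {ν : Measure α} [IsFiniteMeasure ν] {f : α → ℝ} {r : ℝ}
    (hr : 1 ≤ r) (hf : Integrable f ν) (hfr : Integrable (fun x => |f x| ^ r) ν) :
    |∫ x, f x ∂ν| ^ r ≤ ν.real univ ^ (r - 1) * ∫ x, |f x| ^ r ∂ν := by
  have hr0 : 0 < r := by linarith
  rcases eq_zero_or_neZero ν with rfl | _
  · simp [hr0.ne']
  set m := ν.real univ
  have hm : 0 < m := measureReal_univ_pos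
  have jensen : (m⁻¹ * ∫ x, |f x| ∂ν) ^ r ≤ m⁻¹ * ∫ x, |f x| ^ r ∂ν := by
    simpa only [average_eq, smul_eq_mul] using (convexOn_rpow hr).map_average_le
      (Real.continuous_rpow_const hr0.le).continuousOn isClosed_Ici
      (ae_of_all ν fun x => abs_nonneg (f x)) hf.abs hfr
  calc |∫ x, f x ∂ν| ^ r ≤ (m * (m⁻¹ * ∫ x, |f x| ∂ν)) ^ r := by
        rw [mul_inv_cancel_left₀ hm.ne']
        gcongr
        exact abs_integral_le_integral_abs
    _ = m ^ r * (m⁻¹ * ∫ x, |f x| ∂ν) ^ r := Real.mul_rpow hm.le (by positivity)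
    _ ≤ m ^ r * (m⁻¹ * ∫ x, |f x| ^ r ∂ν) := by gcongr
    _ = m ^ (r - 1) * ∫ x, |f x| ^ r ∂ν := by
        rw [Real.rpow_sub_one hm.ne']
        ring

theorem abs_intervalIntegral_mul_rpow_le {r τ D : ℝ} {U k h φ : ℝ → ℝ} (hr : 1 ≤ r)
    (hτ : 0 ≤ τ) (hU : ContinuousOn U (Icc 0 τ)) (hk : ContinuousOn k (Icc 0 τ))
    (hφ : ContinuousOn φ (Icc 0 τ)) (hh : IntegrableOn h (Icc 0 τ))
    (hUh : ∀ᵐ s ∂volume.restrict (Icc 0 τ), |U s| ^ r ≤ h s)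
    (hkφ : ∀ s ∈ Icc 0 τ, |k s| ^ r ≤ D * φ s) :
    |∫ s in (0 : ℝ)..τ, U s * k s| ^ r ≤ D * τ ^ (r - 1) * ∫ s in (0 : ℝ)..τ, h s * φ s := by
  have hr0 : 0 ≤ r := by linarith
  simp only [intervalIntegral.integral_of_le hτ, ← integral_Icc_eq_integral_Ioc]
  have hUk : ContinuousOn (fun s => U s * k s) (Icc 0 τ) := hU.mul hk
  have hUkr : IntegrableOn (fun s => |U s * k s| ^ r) (Icc 0 τ) :=
    (hUk.abs.rpow_const fun _ _ => Or.inr hr0).integrableOn_Icc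
  have pointwise : ∫ s in Icc 0 τ, |U s * k s| ^ r ≤ ∫ s in Icc 0 τ, D * (h s * φ s) := by
    refine integral_mono_ae hUkr ((hh.mul_continuousOn hφ isCompact_Icc).const_mul D) ?_
    filter_upwards [hUh, ae_restrict_mem measurableSet_Icc] with s hs hsτ
    calc |U s * k s| ^ r = |U s| ^ r * |k s| ^ r := by
          rw [abs_mul, Real.mul_rpow (abs_nonneg _) (abs_nonneg _)]
      _ ≤ h s * (D * φ s) :=
          mul_le_mul hs (hkφ s hsτ) (by positivity) ((by positivity : 0 ≤ |U s| ^ r).trans hs)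
      _ = D * (h s * φ s) := by ring
  calc |∫ s in Icc 0 τ, U s * k s| ^ r
      ≤ τ ^ (r - 1) * ∫ s in Icc 0 τ, |U s * k s| ^ r := by
        simpa [hτ] using abs_integral_rpow_le hr hUk.integrableOn_Icc hUkr
    _ ≤ τ ^ (r - 1) * ∫ s in Icc 0 τ, D * (h s * φ s) := by gcongr
    _ = D * τ ^ (r - 1) * ∫ s in Icc 0 τ, h s * φ s := by
        rw [integral_const_mul]
        ring

variable {μ : Measure α}

theorem Lp_integral_nonneg {p : ℝ≥0∞} {f : Lp ℝ p μ} (hf : 0 ≤ f) : 0 ≤ ∫ x, f x ∂μ :=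
  integral_nonneg_of_ae ((Lp.coeFn_nonneg f).2 hf)

theorem Lp_integral_eq_zero_iff {p : ℝ≥0∞} [Fact (1 ≤ p)] [IsFiniteMeasure μ] {f : Lp ℝ p μ}
    (hf : 0 ≤ f) : ∫ x, f x ∂μ = 0 ↔ f = 0 := by
  rw [integral_eq_zero_iff_of_nonneg_ae ((Lp.coeFn_nonneg f).2 hf)
    ((Lp.memLp f).integrable Fact.out), Lp.eq_zero_iff_ae_eq_zero]

theorem Lp_integral_pos_iff {p : ℝ≥0∞} [Fact (1 ≤ p)] [IsFiniteMeasure μ] {f : Lp ℝ p μ}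
    (hf : 0 ≤ f) : 0 < ∫ x, f x ∂μ ↔ f ≠ 0 := by
  rw [(Lp_integral_nonneg hf).lt_iff_ne', ne_eq, Lp_integral_eq_zero_iff hf]

theorem continuous_integral_Lp_two [IsFiniteMeasure μ] :
    Continuous fun f : Lp ℝ 2 μ => ∫ x, f x ∂μ := by
  have inner_one (f : Lp ℝ 2 μ) : ∫ x, f x ∂μ =
      inner ℝ (indicatorConstLp 2 MeasurableSet.univ (measure_ne_top μ univ) (1 : ℝ)) f := by
    rw [L2.inner_indicatorConstLp_one, setIntegral_univ]
  simp only [inner_one]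
  fun_prop

theorem MemLrLoc.exists_integrable_rpow {T r τ : ℝ} {u : ℝ → Lp ℝ 2 μ}
    (h : MemLrLoc μ T r u) (hr : 0 < r) (hτ : 0 ≤ τ) (hτT : τ < T) :
    ∃ w : ℝ × α → ℝ, (∀ᵐ s ∂volume.restrict (Icc 0 τ), (fun x => w (s, x)) =ᵐ[μ] u s) ∧
      Integrable (fun z => |w z| ^ r) ((volume.restrict (Icc 0 τ)).prod μ) := by
  obtain ⟨w, hwu, hw⟩ := h
  refine ⟨w, ae_restrict_of_ae_restrict_of_subset (Icc_subset_Ico_right hτT) hwu, ?_⟩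
  simpa [ENNReal.toReal_ofReal hr.le] using
    (hw τ ⟨hτ, hτT⟩).integrable_norm_rpow (by simpa using hr) ENNReal.ofReal_ne_top

theorem MemLrLoc.integrableOn_integral_rpow [SFinite μ] {T r τ : ℝ} {u : ℝ → Lp ℝ 2 μ}
    (h : MemLrLoc μ T r u) (hr : 0 < r) (hτ : 0 ≤ τ) (hτT : τ < T) :
    IntegrableOn (fun s => ∫ x, |u s x| ^ r ∂μ) (Icc 0 τ) := by
  obtain ⟨w, hwu, hw⟩ := h.exists_integrable_rpow hr hτ hτT
  refine hw.integral_prod_left.congr ?_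
  filter_upwards [hwu] with s hs
  exact integral_congr_ae (hs.fun_comp fun y => |y| ^ r)

theorem MemLrLoc.ae_abs_integral_rpow_le [IsProbabilityMeasure μ] {T r τ : ℝ}
    {u : ℝ → Lp ℝ 2 μ} (h : MemLrLoc μ T r u) (hr : 1 ≤ r) (hτ : 0 ≤ τ) (hτT : τ < T) :
    ∀ᵐ s ∂volume.restrict (Icc 0 τ), |∫ x, u s x ∂μ| ^ r ≤ ∫ x, |u s x| ^ r ∂μ := by
  obtain ⟨w, hwu, hw⟩ := h.exists_integrable_rpow (by linarith) hτ hτT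
  filter_upwards [hwu, hw.prod_right_ae] with s hs hws
  simpa using abs_integral_rpow_le hr ((Lp.memLp (u s)).integrable one_le_two)
    (hws.congr (hs.fun_comp fun y => |y| ^ r))

/-- The source term `∫₀^τ ∫ |F|^r φ(s) dμ ds` of the weak relation, for a weight `φ` depending on
time only. -/
noncomputable def weightedSource (μ : Measure α) (r : ℝ) (φ : ℝ → ℝ) (τ : ℝ) (F : ℝ → Lp ℝ 2 μ) :
    ℝ :=
  ∫ s in (0 : ℝ)..τ, (∫ x, |F s x| ^ r ∂μ) * φ s

theorem weightedSource_nonneg {μ : Measure α} {r τ : ℝ} {φ : ℝ → ℝ} (hτ : 0 ≤ τ)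
    (hφ : ∀ s, 0 ≤ φ s) (F : ℝ → Lp ℝ 2 μ) : 0 ≤ weightedSource μ r φ τ F :=
  intervalIntegral.integral_nonneg hτ fun s _ =>
    mul_nonneg (integral_nonneg fun _ => by positivity) (hφ s)

end Means

section WeakRelation

variable {n : ℕ} {M : Type*} [TopologicalSpace M] [ChartedSpace (EuclideanSpace ℝ (Fin n)) M]

theorem isTestFunction_of_time {T τ : ℝ} {φ : ℝ → ℝ} (hφ : ContDiff ℝ ∞ φ) (hτT : τ < T)
    (hφτ : ∀ s, τ ≤ s → φ s = 0) : IsTestFunction (n := n) (M := M) T (fun s _ => φ s) :=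
  ⟨hφ.contMDiff.comp contMDiff_fst, τ, hτT, fun s hs _ => hφτ s hs⟩

variable [IsManifold (𝓡 n) ∞ M]

theorem laplaceBeltrami_const (g : SmoothMetric n M) (c : ℝ) (x : M) :
    laplaceBeltrami g (fun _ => c) x = 0 := by
  simp [laplaceBeltrami, partialDeriv, Function.comp_def]

variable [MeasurableSpace M] {g : SmoothMetric n M} {μ : Measure M} {b m r r' ε T τ : ℝ}
  {u₀ u₁ : Lp ℝ 2 μ} {u F : ℝ → Lp ℝ 2 μ} {φ : ℝ → ℝ}

-- `φ` and `deriv φ` vanish at `τ`, so the boundary terms at time `τ` drop out.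
theorem WeakWaveRelation.weightedSource_add_eq (h : WeakWaveRelation g μ b m r ε T u₀ u₁ u F)
    (hτ : 0 < τ) (hτT : τ < T) (hφ : ContDiff ℝ ∞ φ) (hφτ : ∀ s, τ ≤ s → φ s = 0) :
    weightedSource μ r φ τ F +
        ε * (φ 0 * ((∫ x, u₁ x ∂μ) + b * ∫ x, u₀ x ∂μ) - deriv φ 0 * ∫ x, u₀ x ∂μ) =
      ∫ s in (0 : ℝ)..τ,
        (∫ x, u s x ∂μ) * (iteratedDeriv 2 φ s - b * deriv φ s + m ^ 2 * φ s) := by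
  have deriv_eq_zero : deriv φ τ = 0 :=
    (uniqueDiffOn_Ici τ τ self_mem_Ici).eq_deriv _
      (hφ.differentiable (by simp) τ).hasDerivAt.hasDerivWithinAt
      ((hasDerivWithinAt_const τ _ (0 : ℝ)).congr hφτ (hφτ τ le_rfl))
  have relation := h _ (isTestFunction_of_time hφ hτT hφτ) τ ⟨hτ, hτT⟩
  beta_reduce at relation
  simp only [laplaceBeltrami_const, integral_mul_const, hφτ τ le_rfl, deriv_eq_zero, sub_zero,
    mul_zero, add_zero, zero_sub, integral_zero] at relation
  rw [weightedSource, relation]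
  ring

theorem WeakWaveRelation.weightedSource_add_rpow_le [IsProbabilityMeasure μ] {D A : ℝ}
    (h : WeakWaveRelation g μ b m r ε T u₀ u₁ u F) (hu : ContinuousOn u (Ico 0 T))
    (hur : MemLrLoc μ T r' u) (hr' : 1 ≤ r') (hτ : 0 < τ) (hτT : τ < T)
    (hφ : ContDiff ℝ ∞ φ) (hφ0 : ∀ s, 0 ≤ φ s) (hφτ : ∀ s, τ ≤ s → φ s = 0)
    (hφD : ∀ s, 0 ≤ s →
      |iteratedDeriv 2 φ s - b * deriv φ s + m ^ 2 * φ s| ^ r' ≤ D * φ s)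
    (hA : 0 ≤ A)
    (hA_le : A ≤
      ε * (φ 0 * ((∫ x, u₁ x ∂μ) + b * ∫ x, u₀ x ∂μ) - deriv φ 0 * ∫ x, u₀ x ∂μ)) :
    (weightedSource μ r φ τ F + A) ^ r' ≤ D * τ ^ (r' - 1) * weightedSource μ r' φ τ u := by
  have : 0 ≤ r' := by linarith
  have hmean : ContinuousOn (fun s => ∫ x, u s x ∂μ) (Icc 0 τ) :=
    continuous_integral_Lp_two.comp_continuousOn (hu.mono (Icc_subset_Ico_right hτT))
  have hkernel : Continuous fun s => iteratedDeriv 2 φ s - b * deriv φ s + m ^ 2 * φ s := by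
    have := hφ.continuous_iteratedDeriv 2 (by exact WithTop.coe_le_coe.2 le_top)
    have := hφ.continuous_deriv (by simp)
    have := hφ.continuous
    fun_prop
  have hX := weightedSource_nonneg (r := r) hτ.le hφ0 F
  calc (weightedSource μ r φ τ F + A) ^ r'
      ≤ |∫ s in (0 : ℝ)..τ, (∫ x, u s x ∂μ) *
          (iteratedDeriv 2 φ s - b * deriv φ s + m ^ 2 * φ s)| ^ r' := by
        rw [← h.weightedSource_add_eq hτ hτT hφ hφτ]
        gcongr
        exact (by gcongr : _ ≤ _).trans (le_abs_self _)
    _ ≤ D * τ ^ (r' - 1) * weightedSource μ r' φ τ u :=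
        abs_intervalIntegral_mul_rpow_le hr' hτ.le hmean hkernel.continuousOn
          hφ.continuous.continuousOn (hur.integrableOn_integral_rpow (by linarith) hτ.le hτT)
          (hur.ae_abs_integral_rpow_le hr' hτ.le hτT) fun s hs => hφD s hs.1

theorem exists_damped_weightedSource_rpow_le (g : SmoothMetric n M) (μ : Measure M)
    [IsProbabilityMeasure μ] (b : ℝ) (hr' : 1 < r') :
    ∃ K : ℝ, 0 ≤ K ∧ ∀ {r ε T τ : ℝ} {u₀ u₁ : Lp ℝ 2 μ} {u F : ℝ → Lp ℝ 2 μ},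
      WeakWaveRelation g μ b 0 r ε T u₀ u₁ u F → InEnergyClass g μ T r' u → 0 ≤ ε → 1 ≤ τ →
      τ < T → 0 ≤ ∫ x, u₀ x ∂μ → 0 ≤ (∫ x, u₁ x ∂μ) + b * ∫ x, u₀ x ∂μ →
      (weightedSource μ r (timeCutoff τ) τ F +
          ε * (Real.exp (-1) * ((∫ x, u₁ x ∂μ) + b * ∫ x, u₀ x ∂μ))) ^ r' ≤
        K * τ ^ (-1 : ℝ) * weightedSource μ r' (timeCutoff τ) τ u := by
  obtain ⟨K, hK, hφK⟩ := exists_abs_damped_timeCutoff_rpow_le b hr'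
  refine ⟨K, hK, fun {r ε T τ u₀ u₁ u F} h hu hε hτ hτT hu₀ hdata => ?_⟩
  have hτ0 : 0 < τ := by linarith
  have exponent : K * τ ^ (-1 : ℝ) = K * τ ^ (-r') * τ ^ (r' - 1) := by
    rw [mul_assoc, ← Real.rpow_add hτ0]
    ring_nf
  rw [exponent]
  refine h.weightedSource_add_rpow_le hu.1.1 hu.2.2 hr'.le hτ0 hτT (contDiff_timeCutoff τ)
    (timeCutoff_nonneg τ) (fun s => timeCutoff_eq_zero hτ0)
    (fun s hs => by simpa using hφK τ s hτ hs) (by positivity) ?_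
  rw [timeCutoff_zero_right, deriv_timeCutoff_zero, neg_mul, sub_neg_eq_add]
  gcongr
  exact le_add_of_nonneg_right (by positivity)

theorem exists_undamped_weightedSource_rpow_le (g : SmoothMetric n M) (μ : Measure M)
    [IsProbabilityMeasure μ] (hr' : 1 < r') :
    ∃ K : ℝ, 0 ≤ K ∧ ∀ {r ε T τ : ℝ} {v₀ v₁ : Lp ℝ 2 μ} {v F : ℝ → Lp ℝ 2 μ},
      WeakWaveRelation g μ 0 0 r ε T v₀ v₁ v F → InEnergyClass g μ T r' v → 0 ≤ ε → 0 < τ →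
      τ < T → 0 ≤ (∫ x, v₁ x ∂μ) + τ⁻¹ * ∫ x, v₀ x ∂μ →
      (weightedSource μ r (timeCutoff τ) τ F +
          ε * (Real.exp (-1) * ((∫ x, v₁ x ∂μ) + τ⁻¹ * ∫ x, v₀ x ∂μ))) ^ r' ≤
        K * τ ^ (-(r' + 1)) * weightedSource μ r' (timeCutoff τ) τ v := by
  obtain ⟨K, hK, hφK⟩ := exists_abs_iteratedDeriv_two_timeCutoff_rpow_le hr'
  refine ⟨K, hK, fun {r ε T τ v₀ v₁ v F} h hv hε hτ hτT hdata => ?_⟩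
  have exponent : K * τ ^ (-(r' + 1)) = K * τ ^ (-(2 * r')) * τ ^ (r' - 1) := by
    rw [mul_assoc, ← Real.rpow_add hτ]
    ring_nf
  rw [exponent]
  refine h.weightedSource_add_rpow_le hv.1.1 hv.2.2 hr'.le hτ hτT (contDiff_timeCutoff τ)
    (timeCutoff_nonneg τ) (fun s => timeCutoff_eq_zero hτ)
    (fun s hs => by simpa using hφK τ s hτ hs) (by positivity) (le_of_eq ?_)
  rw [timeCutoff_zero_right, deriv_timeCutoff_zero]
  ring

end WeakRelation

section Elimination

theorem rpow_mul_rpow_le_of_coupled {p q X Y A K L α β τ : ℝ} (hp : 1 < p) (hq : 1 < q)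
    (hX : 0 ≤ X) (hY : 0 ≤ Y) (hA : 0 ≤ A) (hK : 0 ≤ K) (hL : 0 ≤ L) (hτ : 0 < τ)
    (h₁ : (X + A) ^ q ≤ K * τ ^ (-α) * Y) (h₂ : Y ^ p ≤ L * τ ^ (-β) * X) :
    A ^ (p * q - 1) * τ ^ (α * p + β) ≤ K ^ p * L := by
  have : 0 < p := by linarith
  have hpq : 0 < p * q - 1 := by nlinarith
  rcases hA.eq_or_lt with rfl | hA'
  · rw [Real.zero_rpow hpq.ne', zero_mul]
    positivity
  set S := X + A
  have hS : 0 < S := by positivity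
  have hXS : X ≤ S := le_add_of_nonneg_right hA
  have hAS : A ≤ S := le_add_of_nonneg_left hX
  have eliminated : S ^ (p * q - 1) * S ≤ K ^ p * L * τ ^ (-(α * p + β)) * S := by
    calc S ^ (p * q - 1) * S = (S ^ q) ^ p := by
          rw [← Real.rpow_mul hS.le, mul_comm q p, ← Real.rpow_add_one hS.ne', sub_add_cancel]
      _ ≤ (K * τ ^ (-α) * Y) ^ p := by gcongr
      _ = K ^ p * τ ^ (-(α * p)) * Y ^ p := by
          rw [Real.mul_rpow (by positivity) hY, Real.mul_rpow hK (by positivity),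
            ← Real.rpow_mul hτ.le, neg_mul]
      _ ≤ K ^ p * τ ^ (-(α * p)) * (L * τ ^ (-β) * S) := by
          gcongr
          exact h₂.trans (by gcongr)
      _ = K ^ p * L * τ ^ (-(α * p + β)) * S := by
          rw [neg_add, Real.rpow_add hτ]
          ring
  calc A ^ (p * q - 1) * τ ^ (α * p + β)
      ≤ K ^ p * L * τ ^ (-(α * p + β)) * τ ^ (α * p + β) := by
        gcongr
        exact (by gcongr : A ^ (p * q - 1) ≤ S ^ (p * q - 1)).trans
          (le_of_mul_le_mul_right eliminated hS)
    _ = K ^ p * L := by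
        rw [mul_assoc, ← Real.rpow_add hτ, neg_add_cancel, Real.rpow_zero, mul_one]

theorem exists_le_mul_rpow_of_rpow_mul_rpow_le {Q a m K : ℝ} (hQ : 0 < Q) (ha : 0 ≤ a)
    (hm : 0 < m) (hK : 0 ≤ K) :
    ∃ C : ℝ, 0 < C ∧ ∀ ε T : ℝ, 0 < ε → ε ≤ 1 →
      (∀ τ, 1 ≤ τ → τ < T → (ε * Q) ^ a * τ ^ m ≤ K) → T ≤ C * ε ^ (-(a / m)) := by
  refine ⟨max 1 ((K / Q ^ a) ^ m⁻¹), by positivity, fun ε T hε hε1 h => ?_⟩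
  have one_le : 1 ≤ ε ^ (-(a / m)) :=
    Real.one_le_rpow_of_pos_of_le_one_of_nonpos hε hε1 (neg_nonpos.2 (by positivity))
  refine le_of_forall_lt_imp_le_of_dense fun τ hτT => ?_
  rcases le_or_gt τ 1 with hτ | hτ
  · exact hτ.trans (one_le_mul_of_one_le_of_one_le (le_max_left _ _) one_le)
  have hτ0 : 0 < τ := by linarith
  have rpow_le : τ ^ m ≤ K / Q ^ a * ε ^ (-a) := by
    have hτK := h τ hτ.le hτT
    rw [Real.mul_rpow hε.le hQ.le] at hτK
    rw [Real.rpow_neg hε.le, ← div_eq_mul_inv, div_div, le_div_iff₀ (by positivity)]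
    linarith
  calc τ = (τ ^ m) ^ m⁻¹ := (Real.rpow_rpow_inv hτ0.le hm.ne').symm
    _ ≤ (K / Q ^ a * ε ^ (-a)) ^ m⁻¹ := by gcongr
    _ = (K / Q ^ a) ^ m⁻¹ * ε ^ (-(a / m)) := by
        rw [Real.mul_rpow (by positivity) (by positivity), ← Real.rpow_mul hε.le, neg_mul,
          div_eq_mul_inv a]
    _ ≤ max 1 ((K / Q ^ a) ^ m⁻¹) * ε ^ (-(a / m)) := by
        gcongr
        exact le_max_right _ _

end Elimination

section Lifespan

variable {n : ℕ} {M : Type*} [TopologicalSpace M] [ChartedSpace (EuclideanSpace ℝ (Fin n)) M]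
  [IsManifold (𝓡 n) ∞ M] [MeasurableSpace M]

theorem IsEnergySolution.exists_data_rpow_le (g : SmoothMetric n M) (μ : Measure M)
    [IsProbabilityMeasure μ] (b : ℝ) {p q : ℝ} (hp : 1 < p) (hq : 1 < q) :
    ∃ K : ℝ, 0 ≤ K ∧ ∀ {ε T τ : ℝ} {u₀ u₁ v₀ v₁ : Lp ℝ 2 μ} {u v : ℝ → Lp ℝ 2 μ},
      IsEnergySolution g μ b 0 p q ε u₀ u₁ v₀ v₁ T u v → 0 ≤ ε → 1 ≤ τ → τ < T →
      0 ≤ ∫ x, u₀ x ∂μ → 0 ≤ (∫ x, u₁ x ∂μ) + b * ∫ x, u₀ x ∂μ →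
      0 ≤ (∫ x, v₁ x ∂μ) + τ⁻¹ * ∫ x, v₀ x ∂μ →
      (ε * (Real.exp (-1) * ((∫ x, u₁ x ∂μ) + b * ∫ x, u₀ x ∂μ))) ^ (p * q - 1) *
          τ ^ (2 * p + 1) ≤ K ∧
      (ε * (Real.exp (-1) * ((∫ x, v₁ x ∂μ) + τ⁻¹ * ∫ x, v₀ x ∂μ))) ^ (p * q - 1) *
          τ ^ (p * q + q + 1) ≤ K := by
  obtain ⟨K, hK, damped⟩ := exists_damped_weightedSource_rpow_le g μ b hq
  obtain ⟨L, hL, undamped⟩ := exists_undamped_weightedSource_rpow_le g μ hp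
  refine ⟨max (K ^ p * L) (L ^ q * K), by positivity,
    fun {ε T τ u₀ u₁ v₀ v₁ u v} h hε hτ hτT hu₀ hu hv => ?_⟩
  have hτ0 : 0 < τ := by linarith
  obtain ⟨hu_class, hv_class, hu_weak, hv_weak⟩ := h
  have h₁ := damped hu_weak hu_class hε hτ hτT hu₀ hu
  have h₂ := undamped hv_weak hv_class hε hτ0 hτT hv
  set A := ε * (Real.exp (-1) * ((∫ x, u₁ x ∂μ) + b * ∫ x, u₀ x ∂μ))
  set B := ε * (Real.exp (-1) * ((∫ x, v₁ x ∂μ) + τ⁻¹ * ∫ x, v₀ x ∂μ))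
  set X := weightedSource μ p (timeCutoff τ) τ v
  set Y := weightedSource μ q (timeCutoff τ) τ u
  have hX : 0 ≤ X := weightedSource_nonneg hτ0.le (timeCutoff_nonneg τ) v
  have hY : 0 ≤ Y := weightedSource_nonneg hτ0.le (timeCutoff_nonneg τ) u
  have hA : 0 ≤ A := by positivity
  have hB : 0 ≤ B := by positivity
  have hXq : X ^ q ≤ K * τ ^ (-1 : ℝ) * Y :=
    (Real.rpow_le_rpow hX (le_add_of_nonneg_right hA) (by linarith)).trans h₁
  have hYp : Y ^ p ≤ L * τ ^ (-(p + 1)) * X :=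
    (Real.rpow_le_rpow hY (le_add_of_nonneg_right hB) (by linarith)).trans h₂
  constructor
  · rw [show 2 * p + 1 = 1 * p + (p + 1) by ring]
    exact (rpow_mul_rpow_le_of_coupled hp hq hX hY hA hK hL hτ0 h₁ hYp).trans (le_max_left _ _)
  · rw [show p * q - 1 = q * p - 1 by ring, show p * q + q + 1 = (p + 1) * q + 1 by ring]
    exact (rpow_mul_rpow_le_of_coupled hq hp hY hX hB hL hK hτ0 h₂ hXq).trans (le_max_right _ _)

/-- The time of existence of the energy solutions with Cauchy data `ε (u₀, u₁)` and `ε (v₀, v₁)`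
is `O(ε^(-κ))` for `0 < ε ≤ 1`, uniformly in the solution. The mass is `0`. -/
def ExistenceTimeBound (g : SmoothMetric n M) (μ : Measure M) (b p q : ℝ)
    (u₀ u₁ v₀ v₁ : Lp ℝ 2 μ) (κ : ℝ) : Prop :=
  ∃ C : ℝ, 0 < C ∧ ∀ ε : ℝ, 0 < ε → ε ≤ 1 → ∀ (T : ℝ) (u v : ℝ → Lp ℝ 2 μ),
    IsEnergySolution g μ b 0 p q ε u₀ u₁ v₀ v₁ T u v → T ≤ C * ε ^ (-κ)

variable {g : SmoothMetric n M} {μ : Measure M} {b p q : ℝ} {u₀ u₁ v₀ v₁ : Lp ℝ 2 μ}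

theorem ExistenceTimeBound.div_max {a k l : ℝ}
    (hk : ExistenceTimeBound g μ b p q u₀ u₁ v₀ v₁ (a / k))
    (hl : ExistenceTimeBound g μ b p q u₀ u₁ v₀ v₁ (a / l)) :
    ExistenceTimeBound g μ b p q u₀ u₁ v₀ v₁ (a / max k l) := by
  rcases max_choice k l with h | h <;> rwa [h]

theorem ExistenceTimeBound.exists_lifespan_le {κ : ℝ}
    (h : ExistenceTimeBound g μ b p q u₀ u₁ v₀ v₁ κ) :
    ∃ C : ℝ, 0 < C ∧ ∀ ε : ℝ, 0 < ε → ε ≤ 1 → ∀ u v : ℝ → Lp ℝ 2 μ,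
      lifespan g μ b 0 p q ε u₀ u₁ v₀ v₁ u v ≤ ENNReal.ofReal (C * ε ^ (-κ)) := by
  obtain ⟨C, hC, hT⟩ := h
  refine ⟨C, hC, fun ε hε hε1 u v => sSup_le ?_⟩
  rintro _ ⟨T, ⟨-, huv⟩, rfl⟩
  exact ENNReal.ofReal_le_ofReal (hT ε hε hε1 T u v huv)

variable [IsProbabilityMeasure μ]

theorem existenceTimeBound_of_damped_data (hp : 1 < p) (hq : 1 < q)
    (hu₀ : 0 ≤ ∫ x, u₀ x ∂μ) (hu : 0 < (∫ x, u₁ x ∂μ) + b * ∫ x, u₀ x ∂μ)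
    (hv₀ : 0 ≤ ∫ x, v₀ x ∂μ) (hv₁ : 0 ≤ ∫ x, v₁ x ∂μ) :
    ExistenceTimeBound g μ b p q u₀ u₁ v₀ v₁ ((p * q - 1) / (2 * p + 1)) := by
  obtain ⟨K, hK, bound⟩ := IsEnergySolution.exists_data_rpow_le g μ b hp hq
  obtain ⟨C, hC, le_mul⟩ := exists_le_mul_rpow_of_rpow_mul_rpow_le
    (a := p * q - 1) (m := 2 * p + 1) (mul_pos (Real.exp_pos (-1)) hu) (by nlinarith)
    (by linarith) hK
  exact ⟨C, hC, fun ε hε hε1 T u v huv => le_mul ε T hε hε1 fun τ hτ hτT =>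
    (bound huv hε.le hτ hτT hu₀ hu.le (by positivity)).1⟩

theorem existenceTimeBound_of_undamped_velocity (hp : 1 < p) (hq : 1 < q)
    (hu₀ : 0 ≤ ∫ x, u₀ x ∂μ) (hu : 0 ≤ (∫ x, u₁ x ∂μ) + b * ∫ x, u₀ x ∂μ)
    (hv₀ : 0 ≤ ∫ x, v₀ x ∂μ) (hv₁ : 0 < ∫ x, v₁ x ∂μ) :
    ExistenceTimeBound g μ b p q u₀ u₁ v₀ v₁ ((p * q - 1) / (p * q + q + 1)) := by
  obtain ⟨K, hK, bound⟩ := IsEnergySolution.exists_data_rpow_le g μ b hp hq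
  have hpq : 0 ≤ p * q - 1 := by nlinarith
  obtain ⟨C, hC, le_mul⟩ := exists_le_mul_rpow_of_rpow_mul_rpow_le
    (m := p * q + q + 1) (mul_pos (Real.exp_pos (-1)) hv₁) hpq (by linarith) hK
  refine ⟨C, hC, fun ε hε hε1 T u v huv => le_mul ε T hε hε1 fun τ hτ hτT => ?_⟩
  refine le_trans ?_ (bound huv hε.le hτ hτT hu₀ hu (by positivity)).2
  gcongr
  exact le_add_of_nonneg_right (by positivity)

theorem existenceTimeBound_of_undamped_position (hp : 1 < p) (hq : 1 < q)
    (hu₀ : 0 ≤ ∫ x, u₀ x ∂μ) (hu : 0 ≤ (∫ x, u₁ x ∂μ) + b * ∫ x, u₀ x ∂μ)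
    (hv₀ : 0 < ∫ x, v₀ x ∂μ) (hv₁ : 0 ≤ ∫ x, v₁ x ∂μ) :
    ExistenceTimeBound g μ b p q u₀ u₁ v₀ v₁ ((p * q - 1) / (q + 2)) := by
  obtain ⟨K, hK, bound⟩ := IsEnergySolution.exists_data_rpow_le g μ b hp hq
  have hpq : 0 ≤ p * q - 1 := by nlinarith
  obtain ⟨C, hC, le_mul⟩ := exists_le_mul_rpow_of_rpow_mul_rpow_le
    (m := q + 2) (mul_pos (Real.exp_pos (-1)) hv₀) hpq (by linarith) hK
  refine ⟨C, hC, fun ε hε hε1 T u v huv => le_mul ε T hε hε1 fun τ hτ hτT => ?_⟩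
  have hτ0 : 0 < τ := by linarith
  -- The factor `τ⁻¹` in front of the mean of `v₀` costs `p * q - 1` powers of `τ`.
  calc (ε * (Real.exp (-1) * ∫ x, v₀ x ∂μ)) ^ (p * q - 1) * τ ^ (q + 2)
      = (ε * (Real.exp (-1) * ∫ x, v₀ x ∂μ) / τ) ^ (p * q - 1) * τ ^ (p * q + q + 1) := by
        rw [Real.div_rpow (by positivity) hτ0.le, div_mul_eq_mul_div, mul_div_assoc,
          ← Real.rpow_sub hτ0]
        congr 2
        ring
    _ = (ε * (Real.exp (-1) * (τ⁻¹ * ∫ x, v₀ x ∂μ))) ^ (p * q - 1) * τ ^ (p * q + q + 1) := by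
        congr 2
        ring
    _ ≤ (ε * (Real.exp (-1) * ((∫ x, v₁ x ∂μ) + τ⁻¹ * ∫ x, v₀ x ∂μ))) ^ (p * q - 1) *
          τ ^ (p * q + q + 1) := by
        gcongr
        exact le_add_of_nonneg_left hv₁
    _ ≤ K := (bound huv hε.le hτ hτT hu₀ hu (by positivity)).2

end Lifespan

theorem theorem2p2_general {n : ℕ} {M : Type*} [TopologicalSpace M]
    [ChartedSpace (EuclideanSpace ℝ (Fin n)) M] [IsManifold (𝓡 n) ∞ M] [MeasurableSpace M]
    (μ : Measure M) [IsProbabilityMeasure μ] (g : SmoothMetric n M)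
    {b p q : ℝ} (hp : 1 < p) (hq : 1 < q) {u₀ u₁ v₀ v₁ : Lp ℝ 2 μ}
    (hu₀ : 0 ≤ ∫ x, u₀ x ∂μ) (hu : 0 < (∫ x, u₁ x ∂μ) + b * ∫ x, u₀ x ∂μ)
    (hv₀ : 0 ≤ ∫ x, v₀ x ∂μ) (hv₁ : 0 ≤ ∫ x, v₁ x ∂μ)
    (hv : 0 < ∫ x, v₀ x ∂μ ∨ 0 < ∫ x, v₁ x ∂μ) :
    ∃ ε₀ : ℝ, 0 < ε₀ ∧ ∃ C : ℝ, 0 < C ∧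
      ∀ ε : ℝ, 0 < ε → ε ≤ ε₀ → ∀ u v : ℝ → Lp ℝ 2 μ,
        (∃ T : ℝ, 0 < T ∧ IsEnergySolution g μ b 0 p q ε u₀ u₁ v₀ v₁ T u v) →
        lifespan g μ b 0 p q ε u₀ u₁ v₀ v₁ u v < ⊤ ∧
        (0 < ∫ x, v₁ x ∂μ → lifespan g μ b 0 p q ε u₀ u₁ v₀ v₁ u v ≤
          ENNReal.ofReal (C * ε ^ (-((p * q - 1) / max (2 * p + 1) (p * q + q + 1))))) ∧
        (∫ x, v₁ x ∂μ = 0 → lifespan g μ b 0 p q ε u₀ u₁ v₀ v₁ u v ≤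
          ENNReal.ofReal (C * ε ^ (-((p * q - 1) / max (2 * p + 1) (q + 2))))) := by
  have damped : ExistenceTimeBound g μ b p q u₀ u₁ v₀ v₁ ((p * q - 1) / (2 * p + 1)) :=
    existenceTimeBound_of_damped_data hp hq hu₀ hu hv₀ hv₁
  rcases hv₁.eq_or_lt with hv₁_zero | hv₁_pos
  · have hv₀_pos := hv.resolve_right hv₁_zero.not_lt
    obtain ⟨C, hC, le⟩ := (damped.div_max
      (existenceTimeBound_of_undamped_position hp hq hu₀ hu.le hv₀_pos hv₁)).exists_lifespan_le
    exact ⟨1, one_pos, C, hC, fun ε hε hε1 u v _ =>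
      ⟨(le ε hε hε1 u v).trans_lt ENNReal.ofReal_lt_top,
        fun h => absurd hv₁_zero h.ne, fun _ => le ε hε hε1 u v⟩⟩
  · obtain ⟨C, hC, le⟩ := (damped.div_max
      (existenceTimeBound_of_undamped_velocity hp hq hu₀ hu.le hv₀ hv₁_pos)).exists_lifespan_le
    exact ⟨1, one_pos, C, hC, fun ε hε hε1 u v _ =>
      ⟨(le ε hε hε1 u v).trans_lt ENNReal.ofReal_lt_top,
        fun _ => le ε hε hε1 u v, fun h => absurd h hv₁_pos.ne'⟩⟩

theorem theorem2p2 {n : ℕ} {G : Type*} [Group G] [TopologicalSpace G]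
    [ChartedSpace (EuclideanSpace ℝ (Fin n)) G] [LieGroup (𝓡 n) ∞ G]
    [CompactSpace G] [T2Space G] [MeasurableSpace G] [BorelSpace G]
    (μ : Measure G) [μ.IsHaarMeasure] [IsProbabilityMeasure μ]
    (g : SmoothMetric n G) (hg : IsBiinvariantMetric g)
    (b p q : ℝ) (hb : 0 < b) (hp : 1 < p) (hq : 1 < q)
    (u₀ u₁ v₀ v₁ : Lp ℝ 2 μ)
    (hu₀ : MemSobolevH1 g μ u₀) (hv₀ : MemSobolevH1 g μ v₀)
    (hu₀_nonneg : 0 ≤ u₀) (hu₁_nonneg : 0 ≤ u₁) (hv₀_nonneg : 0 ≤ v₀) (hv₁_nonneg : 0 ≤ v₁)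
    (hu : u₀ ≠ 0 ∨ u₁ ≠ 0) (hv : v₀ ≠ 0 ∨ v₁ ≠ 0) :
    ∃ ε₀ : ℝ, 0 < ε₀ ∧ ∃ C : ℝ, 0 < C ∧
      ∀ ε : ℝ, 0 < ε → ε ≤ ε₀ → ∀ u v : ℝ → Lp ℝ 2 μ,
        (∃ T : ℝ, 0 < T ∧ IsEnergySolution g μ b 0 p q ε u₀ u₁ v₀ v₁ T u v) →
        lifespan g μ b 0 p q ε u₀ u₁ v₀ v₁ u v < ⊤ ∧
        (v₁ ≠ 0 → lifespan g μ b 0 p q ε u₀ u₁ v₀ v₁ u v ≤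
          ENNReal.ofReal (C * ε ^ (-((p * q - 1) / max (2 * p + 1) (p * q + q + 1))))) ∧
        (v₁ = 0 → lifespan g μ b 0 p q ε u₀ u₁ v₀ v₁ u v ≤
          ENNReal.ofReal (C * ε ^ (-((p * q - 1) / max (2 * p + 1) (q + 2))))) := by
  have hdata : 0 < (∫ x, u₁ x ∂μ) + b * ∫ x, u₀ x ∂μ := by
    have hu₀_mean := Lp_integral_nonneg hu₀_nonneg
    have hu₁_mean := Lp_integral_nonneg hu₁_nonneg
    rw [← Lp_integral_pos_iff hu₀_nonneg, ← Lp_integral_pos_iff hu₁_nonneg] at hu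
    rcases hu with hu | hu <;> positivity
  simpa only [Lp_integral_pos_iff hv₁_nonneg, Lp_integral_eq_zero_iff hv₁_nonneg] using
    theorem2p2_general μ g hp hq (Lp_integral_nonneg hu₀_nonneg) hdata
      (Lp_integral_nonneg hv₀_nonneg) (Lp_integral_nonneg hv₁_nonneg)
      (hv.imp (Lp_integral_pos_iff hv₀_nonneg).2 (Lp_integral_pos_iff hv₁_nonneg).2)
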